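/- For a bounded nonempty set $T\subseteq\mathbb{R}^k$, its Gaussian width is $\mathrm{gw}(T)=\mathbb{E}\big[\sup_{x\in T}\langle x,g\rangle\big]$, where $g$ is a standard Gaussian vector in $\mathbb{R}^k$. Say that a polynomial $p\in\mathbb{R}[x_1,\dots,x_n]$ is multilinear if no variable occurs in it with an exponent larger than $1$, and that $p$ has multiplicity $t$ if each of its variables has a nonzero exponent in at most $t$ monomials in its support. Theorem. For every integer $d\ge 1$ there is a constant $C_d\in(0,\infty)$, depending only on $d$, such that the following holds for all integers $n\ge 2$, $k\ge 0$ and $t\ge 0$. Let $\psi:\mathbb{R}^n\to\mathbb{R}^k$ be a polynomial mapping such that each coordinate is multilinear, has coefficients in $\{0,1\}$, and has degree at most $d$ and multiplicity $t$. Then $$\mathrm{gw}\big(\psi(\{0,1\}^n)\big)\;\le\; C_d\, n\,t\,\sqrt{k\,n^{1-\frac{1}{\lceil d/2\rceil}}\,\log n}.$$ -/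

import Mathlib

open MeasureTheory ProbabilityTheory

noncomputable section

/-- The Gaussian width `𝔼 sup_{x ∈ T} ⟨x, g⟩` of a set `T ⊆ ℝᵏ`, where `g` is a standard Gaussian
vector in `ℝᵏ`. (The supremum is taken in `ℝ`; it is a genuine supremum for nonempty bounded
`T`, in particular for nonempty finite `T`.) -/
def gaussianWidth {k : ℕ} (T : Set (EuclideanSpace ℝ (Fin k))) : ℝ :=
  ∫ g, (⨆ x : T, inner ℝ (x : EuclideanSpace ℝ (Fin k)) g)
    ∂(stdGaussian (EuclideanSpace ℝ (Fin k)))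

/-- For a nonempty finite set the integrand in the Gaussian width is integrable, so that the
Bochner integral is the expectation. -/
theorem integrable_iSup_inner_of_finite {k : ℕ} {T : Set (EuclideanSpace ℝ (Fin k))}
    (hT : T.Finite) (hne : T.Nonempty) :
    Integrable (fun g => ⨆ x : T, inner ℝ (x : EuclideanSpace ℝ (Fin k)) g)
      (stdGaussian (EuclideanSpace ℝ (Fin k))) := by
  have := hT.fintype
  have : Nonempty T := hne.to_subtype
  have hid : Integrable (fun g : EuclideanSpace ℝ (Fin k) => g)
      (stdGaussian (EuclideanSpace ℝ (Fin k))) := IsGaussian.integrable_id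
  have h : ∀ x : T, Integrable (fun g => inner ℝ (x : EuclideanSpace ℝ (Fin k)) g)
      (stdGaussian (EuclideanSpace ℝ (Fin k))) := fun x => hid.const_inner _
  refine Integrable.mono' (integrable_finsetSum Finset.univ fun x _ => (h x).norm) ?_ ?_
  · exact (Measurable.iSup fun x => by fun_prop).aestronglyMeasurable
  · refine Filter.Eventually.of_forall fun g => ?_
    obtain ⟨x, hx⟩ := exists_eq_ciSup_of_finite
      (f := fun x : T => inner ℝ (x : EuclideanSpace ℝ (Fin k)) g)
    rw [← hx]
    exact Finset.single_le_sum (f := fun x : T => ‖inner ℝ (x : EuclideanSpace ℝ (Fin k)) g‖)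
      (fun _ _ => norm_nonneg _) (Finset.mem_univ x)

/-- The Boolean hypercube `{0,1}ⁿ ⊆ ℝⁿ`. -/
def booleanCube (n : ℕ) : Set (Fin n → ℝ) :=
  {x | ∀ j, x j = 0 ∨ x j = 1}

/-- The polynomial mapping `ℝⁿ → ℝᵏ` with coordinates `ψ 1, …, ψ k`. -/
def polyMap {n k : ℕ} (ψ : Fin k → MvPolynomial (Fin n) ℝ) (x : Fin n → ℝ) :
    EuclideanSpace ℝ (Fin k) :=
  WithLp.toLp 2 fun i => MvPolynomial.eval x (ψ i)

/-- A polynomial is multilinear if no variable occurs with exponent larger than one. -/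
def IsMultilinearPoly {n : ℕ} (p : MvPolynomial (Fin n) ℝ) : Prop :=
  ∀ m ∈ p.support, ∀ j, m j ≤ 1

/-- All coefficients of `p` are `0` or `1`. -/
def HasZeroOneCoeffs {n : ℕ} (p : MvPolynomial (Fin n) ℝ) : Prop :=
  ∀ m, p.coeff m = 0 ∨ p.coeff m = 1

/-- A polynomial has multiplicity `t` if each variable has a nonzero exponent in at most `t`
monomials of its support. -/
def HasMultiplicity {n : ℕ} (p : MvPolynomial (Fin n) ℝ) (t : ℕ) : Prop :=
  ∀ j, (p.support.filter fun m => m j ≠ 0).card ≤ t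

end

/-!
The bound is proved by bounding random Kikuchi matrices.

Let `r = ⌈d / 2⌉`. On the cube a nonconstant monomial of degree at most `d` is a product of `2 * r`
coordinates, possibly repeated. Writing every coordinate as `(1 + ε) / 2` with a sign `ε` and
expanding, `⟨ψ x, g⟩` becomes the constant term, whose expectation is `0`, plus an average over
`2 ^ (2 * r)` choices of forms `F y = ∑ gᵢ ∑ S ∈ Mᵢ, ∏ c, y (aᵢ S c) * y (bᵢ S c)` at sign vectors
`y` on an alphabet `V` of `2 * n` letters. The multiplicity hypothesis says that every letter occurs
at each place of at most `t` of the tuples `aᵢ S`, and likewise for `bᵢ S`.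

Consider block words, made of `r` blocks of length `m ≈ n ^ (1 - 1 / r)` over `V`. Replacing one
letter `a c` by `b c` in every block multiplies the product of the signs of all letters by
`∏ c, y (a c) * y (b c)`. Hence `F y` is, up to normalisation, the quadratic form of `∑ gᵢ Bᵢ` at the
sign vector `blockSign y`, where `Bᵢ` counts the replacements along the edges in `Mᵢ`. For this
choice of `m` the mean row sum of `Bᵢ` near any edge is `O(t)`, so by Markov's inequality the block
words of large degree can be discarded at the cost of at most half the weight of every edge; the
edges are then reweighted to contribute equally (`exists_kikuchi_matrix`).

The matrices so obtained have nonnegative entries and row sums at most `R = O(t)`. Since mixed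
Gaussian moments are nonnegative, expanding the trace gives
`𝔼 tr (∑ gᵢ Bᵢ) ^ q ≤ N R ^ q 𝔼 (∑ gᵢ) ^ q`, with `N` the number of block words
(`integral_trace_sum_smul_pow_le`). Taking `q` a power of two of order `log N ≈ m log n` bounds the
expected supremum by a constant times `(n / m) ^ r * R * √(k m log n)`, which is of the asserted
order (`exists_integrable_majorant`).
-/

/-! ### Gaussian integrals of polynomials with nonnegative coefficients -/

/-- All coefficients of the polynomial are nonnegative. The relation `NonnegCoeffs (Q - P)` is the
coefficientwise order on polynomials. -/
def NonnegCoeffs {σ : Type*} (P : MvPolynomial σ ℝ) : Prop := ∀ m, 0 ≤ P.coeff m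

namespace NonnegCoeffs

variable {σ : Type*} {P Q : MvPolynomial σ ℝ}

theorem zero : NonnegCoeffs (0 : MvPolynomial σ ℝ) := fun m => by simp

theorem add (hP : NonnegCoeffs P) (hQ : NonnegCoeffs Q) : NonnegCoeffs (P + Q) := fun m => by
  rw [MvPolynomial.coeff_add]
  exact add_nonneg (hP m) (hQ m)

theorem mul (hP : NonnegCoeffs P) (hQ : NonnegCoeffs Q) : NonnegCoeffs (P * Q) := fun m => by
  classical
  rw [MvPolynomial.coeff_mul]
  exact Finset.sum_nonneg fun x _ => mul_nonneg (hP _) (hQ _)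

theorem const {c : ℝ} (hc : 0 ≤ c) : NonnegCoeffs (MvPolynomial.C c : MvPolynomial σ ℝ) :=
  fun m => by
  classical
  rw [MvPolynomial.coeff_C]
  split_ifs <;> simp [hc]

theorem var (i : σ) : NonnegCoeffs (MvPolynomial.X i : MvPolynomial σ ℝ) := fun m => by
  classical
  rw [MvPolynomial.coeff_X]
  split_ifs <;> simp

theorem sum {α : Type*} {s : Finset α} {P : α → MvPolynomial σ ℝ}
    (h : ∀ a ∈ s, NonnegCoeffs (P a)) : NonnegCoeffs (∑ a ∈ s, P a) := fun m => by
  rw [MvPolynomial.coeff_sum]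
  exact Finset.sum_nonneg fun a ha => h a ha m

theorem pow (hP : NonnegCoeffs P) (q : ℕ) : NonnegCoeffs (P ^ q) := by
  induction q with
  | zero => simpa using const (σ := σ) zero_le_one
  | succ q ih => rw [pow_succ]; exact ih.mul hP

end NonnegCoeffs

/-- The law of `k` independent standard Gaussian variables. -/
noncomputable abbrev gaussianPi (k : ℕ) : Measure (Fin k → ℝ) :=
  Measure.pi fun _ => gaussianReal 0 1

theorem integrable_pow_gaussianReal (j : ℕ) :
    Integrable (fun x : ℝ => x ^ j) (gaussianReal 0 1) := by
  have h := (memLp_id_gaussianReal (μ := 0) (v := 1) (j : NNReal)).integrable_norm_pow'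
  refine (integrable_norm_iff (by fun_prop)).1 ?_
  simpa [norm_pow] using h

theorem integral_pow_gaussianReal_nonneg (j : ℕ) : 0 ≤ ∫ x, x ^ j ∂(gaussianReal 0 1) := by
  rcases Nat.even_or_odd j with hj | hj
  · exact integral_nonneg fun x => hj.pow_nonneg x
  · have h : ∫ x, x ^ j ∂(gaussianReal 0 1) = ∫ x, (-x) ^ j ∂(gaussianReal 0 1) := by
      have hm : (gaussianReal 0 1).map (fun x : ℝ => -x) = gaussianReal 0 1 := by
        simpa using gaussianReal_map_neg (μ := 0) (v := 1)
      conv_lhs => rw [← hm]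
      rw [integral_map (by fun_prop) (by fun_prop)]
    simp only [hj.neg_pow, integral_neg] at h
    linarith

theorem integrable_eval_gaussianPi {k : ℕ} (P : MvPolynomial (Fin k) ℝ) :
    Integrable (fun g => MvPolynomial.eval g P) (gaussianPi k) := by
  simp only [MvPolynomial.eval_eq']
  refine integrable_finsetSum _ fun m _ => Integrable.const_mul ?_ _
  exact Integrable.fintype_prod (f := fun i x => x ^ m i) fun i => integrable_pow_gaussianReal _

theorem integral_eval_gaussianPi_nonneg {k : ℕ} {P : MvPolynomial (Fin k) ℝ}
    (hP : NonnegCoeffs P) : 0 ≤ ∫ g, MvPolynomial.eval g P ∂(gaussianPi k) := by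
  simp only [MvPolynomial.eval_eq']
  rw [integral_finsetSum]
  · refine Finset.sum_nonneg fun m _ => ?_
    rw [integral_const_mul, integral_fintype_prod_eq_prod (f := fun i (x : ℝ) => x ^ m i)]
    exact mul_nonneg (hP m) (Finset.prod_nonneg fun i _ => integral_pow_gaussianReal_nonneg _)
  · exact fun m _ => Integrable.const_mul (Integrable.fintype_prod (f := fun i x => x ^ m i)
      fun i => integrable_pow_gaussianReal _) _

theorem integral_eval_gaussianPi_mono {k : ℕ} {P Q : MvPolynomial (Fin k) ℝ}
    (h : NonnegCoeffs (Q - P)) :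
    ∫ g, MvPolynomial.eval g P ∂(gaussianPi k) ≤ ∫ g, MvPolynomial.eval g Q ∂(gaussianPi k) := by
  have := integral_eval_gaussianPi_nonneg h
  simp only [map_sub] at this
  rw [integral_sub (integrable_eval_gaussianPi Q) (integrable_eval_gaussianPi P)] at this
  linarith

theorem integrable_exp_mul_sum_gaussianPi (k : ℕ) (s : ℝ) :
    Integrable (fun g : Fin k → ℝ => Real.exp (s * ∑ i, g i)) (gaussianPi k) := by
  simp only [Finset.mul_sum, Real.exp_sum]
  exact Integrable.fintype_prod (f := fun _ x => Real.exp (s * x))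
    fun i => integrable_exp_mul_gaussianReal s

theorem integral_exp_mul_sum_gaussianPi (k : ℕ) (s : ℝ) :
    ∫ g : Fin k → ℝ, Real.exp (s * ∑ i, g i) ∂(gaussianPi k) = Real.exp (k * s ^ 2 / 2) := by
  simp only [Finset.mul_sum, Real.exp_sum]
  rw [integral_fintype_prod_eq_prod (f := fun _ (x : ℝ) => Real.exp (s * x))]
  have h : ∫ x, Real.exp (s * x) ∂(gaussianReal 0 1) = Real.exp (s ^ 2 / 2) := by
    have := congrFun (mgf_id_gaussianReal (μ := 0) (v := 1)) s
    simpa [mgf] using this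
  rw [Finset.prod_const, h, ← Real.exp_nat_mul]
  simp [mul_div_assoc]

/-- A moment bound of the right order, read off from the moment generating function. -/
theorem integral_sum_pow_gaussianPi_le {k p : ℕ} (hk : 1 ≤ k) (hp : 1 ≤ p) :
    ∫ g : Fin k → ℝ, (∑ i, g i) ^ (2 * p) ∂(gaussianPi k) ≤
      2 * (Real.exp 1 * (k * (2 * p : ℕ))) ^ p := by
  have hk0 : (0 : ℝ) < k := by exact_mod_cast hk
  have hp0 : (0 : ℝ) < p := by exact_mod_cast hp
  -- the value of `s` that minimises `s ^ (-2 * p) * exp (k * s ^ 2 / 2)`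
  set s : ℝ := Real.sqrt ((2 * p : ℕ) / k) with hs
  have hs0 : 0 < s := Real.sqrt_pos.2 (by positivity)
  have hs2 : s ^ 2 = (2 * p : ℕ) / k := Real.sq_sqrt (by positivity)
  have hpt : ∀ x : ℝ, x ^ (2 * p) ≤
      (2 * p : ℕ) ^ (2 * p) * (s ^ (2 * p))⁻¹ * (Real.exp (s * x) + Real.exp (-s * x)) := by
    intro x
    have h1 : (s * |x|) ^ (2 * p) / (2 * p).factorial ≤ Real.exp (s * |x|) :=
      Real.pow_div_factorial_le_exp _ (by positivity) _
    have h2 : Real.exp (s * |x|) ≤ Real.exp (s * x) + Real.exp (-s * x) := by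
      rcases abs_cases x with ⟨h, _⟩ | ⟨h, _⟩ <;> rw [h]
      · exact le_add_of_nonneg_right (Real.exp_nonneg _)
      · rw [mul_neg, ← neg_mul]
        exact le_add_of_nonneg_left (Real.exp_nonneg _)
    have h3 : ((2 * p).factorial : ℝ) ≤ (2 * p : ℕ) ^ (2 * p) := by
      exact_mod_cast Nat.factorial_le_pow _
    rw [div_le_iff₀ (by positivity), mul_pow, Even.pow_abs ⟨p, by ring⟩] at h1
    rw [mul_assoc, mul_left_comm, ← div_eq_inv_mul, le_div_iff₀ (by positivity), mul_comm]
    calc s ^ (2 * p) * x ^ (2 * p) ≤ Real.exp (s * |x|) * (2 * p).factorial := h1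
      _ ≤ (Real.exp (s * x) + Real.exp (-s * x)) * (2 * p : ℕ) ^ (2 * p) := by gcongr
      _ = _ := mul_comm _ _
  have hint : Integrable (fun g : Fin k → ℝ => (∑ i, g i) ^ (2 * p)) (gaussianPi k) := by
    simpa using integrable_eval_gaussianPi ((∑ i, MvPolynomial.X i) ^ (2 * p))
  have hmain : ∫ g : Fin k → ℝ, (∑ i, g i) ^ (2 * p) ∂(gaussianPi k) ≤
      (2 * p : ℕ) ^ (2 * p) * (s ^ (2 * p))⁻¹ *
        (Real.exp (k * s ^ 2 / 2) + Real.exp (k * (-s) ^ 2 / 2)) := by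
    rw [← integral_exp_mul_sum_gaussianPi, ← integral_exp_mul_sum_gaussianPi,
      ← integral_add (integrable_exp_mul_sum_gaussianPi _ _)
        (integrable_exp_mul_sum_gaussianPi _ _), ← integral_const_mul]
    exact integral_mono hint (((integrable_exp_mul_sum_gaussianPi _ _).add
        (integrable_exp_mul_sum_gaussianPi _ _)).const_mul _) fun g => hpt _
  refine hmain.trans (le_of_eq ?_)
  have he : (k : ℝ) * (((2 * p : ℕ) : ℝ) / k) / 2 = p * 1 := by
    push_cast
    field_simp
  rw [neg_sq, pow_mul s, hs2, he, Real.exp_nat_mul, pow_mul _ 2 p, ← inv_pow, ← mul_pow,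
    ← two_mul, mul_left_comm, ← mul_pow]
  congr 2
  field_simp

/-! ### Gaussian series of nonnegative matrices -/

section Trace

variable {ι : Type*} [Fintype ι]

/-- If all row sums of a matrix of polynomials with nonnegative coefficients are coefficientwise at
most `L`, then those of its `q`-th power are coefficientwise at most `L ^ q`. -/
theorem NonnegCoeffs.matrix_pow_rowSum [DecidableEq ι] {σ : Type*}
    {Y : Matrix ι ι (MvPolynomial σ ℝ)} {L : MvPolynomial σ ℝ}
    (hY : ∀ u v, NonnegCoeffs (Y u v)) (hL : NonnegCoeffs L)
    (hrow : ∀ u, NonnegCoeffs (L - ∑ v, Y u v)) (q : ℕ) :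
    (∀ u v, NonnegCoeffs ((Y ^ q) u v)) ∧ ∀ u, NonnegCoeffs (L ^ q - ∑ v, (Y ^ q) u v) := by
  induction q with
  | zero =>
    refine ⟨fun u v => ?_, fun u => ?_⟩
    · rw [pow_zero, Matrix.one_apply]
      split_ifs
      · simpa using NonnegCoeffs.const (σ := σ) zero_le_one
      · exact NonnegCoeffs.zero
    · simpa [Matrix.one_apply] using NonnegCoeffs.zero (σ := σ)
  | succ q ih =>
    obtain ⟨ih₁, ih₂⟩ := ih
    refine ⟨fun u v => ?_, fun u => ?_⟩
    · rw [pow_succ, Matrix.mul_apply]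
      exact NonnegCoeffs.sum fun w _ => (ih₁ u w).mul (hY w v)
    · have h : L ^ (q + 1) - ∑ v, (Y ^ (q + 1)) u v =
          (L ^ q - ∑ w, (Y ^ q) u w) * L + ∑ w, (Y ^ q) u w * (L - ∑ v, Y w v) := by
        simp only [pow_succ, Matrix.mul_apply, mul_sub, sub_mul, Finset.sum_sub_distrib,
          Finset.sum_mul, Finset.mul_sum]
        rw [Finset.sum_comm]
        ring
      rw [h]
      exact ((ih₂ u).mul hL).add (NonnegCoeffs.sum fun w _ => (ih₁ u w).mul (hrow w))

theorem trace_sum_smul_pow_eq_eval [DecidableEq ι] {k : ℕ} (B : Fin k → Matrix ι ι ℝ)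
    (q : ℕ) (g : Fin k → ℝ) :
    ((∑ i, g i • B i) ^ q).trace = MvPolynomial.eval g
      ((Matrix.of fun u v => ∑ i, MvPolynomial.C (B i u v) * MvPolynomial.X i) ^ q).trace := by
  rw [AddMonoidHom.map_trace, ← RingHom.mapMatrix_apply, map_pow]
  congr 2
  ext u v
  simp [Matrix.sum_apply, mul_comm]

theorem integrable_trace_sum_smul_pow [DecidableEq ι] {k : ℕ} (B : Fin k → Matrix ι ι ℝ) (q : ℕ) :
    Integrable (fun g : Fin k → ℝ => ((∑ i, g i • B i) ^ q).trace) (gaussianPi k) := by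
  simp only [trace_sum_smul_pow_eq_eval]
  exact integrable_eval_gaussianPi _

/-- A scalar substitute for the noncommutative Khintchine inequality: for matrices with nonnegative
entries and row sums at most `R`, the trace moments of `∑ gᵢ Bᵢ` are at most those of the scalar
Gaussian variable `R ∑ gᵢ`, up to the dimension factor. -/
theorem integral_trace_sum_smul_pow_le [DecidableEq ι] {k : ℕ} {B : Fin k → Matrix ι ι ℝ} {R : ℝ}
    (hB : ∀ i u v, 0 ≤ B i u v) (hR : 0 ≤ R) (hrow : ∀ i u, ∑ v, B i u v ≤ R) (q : ℕ) :
    ∫ g : Fin k → ℝ, ((∑ i, g i • B i) ^ q).trace ∂(gaussianPi k) ≤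
      Fintype.card ι * R ^ q * ∫ g : Fin k → ℝ, (∑ i, g i) ^ q ∂(gaussianPi k) := by
  set Y : Matrix ι ι (MvPolynomial (Fin k) ℝ) :=
    Matrix.of fun u v => ∑ i, MvPolynomial.C (B i u v) * MvPolynomial.X i with hY
  set L : MvPolynomial (Fin k) ℝ := MvPolynomial.C R * ∑ i, MvPolynomial.X i with hL
  have hY0 : ∀ u v, NonnegCoeffs (Y u v) := fun u v => by
    rw [hY, Matrix.of_apply]
    exact NonnegCoeffs.sum fun i _ => (NonnegCoeffs.const (hB i u v)).mul (NonnegCoeffs.var i)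
  have hL0 : NonnegCoeffs L :=
    (NonnegCoeffs.const hR).mul (NonnegCoeffs.sum fun i _ => NonnegCoeffs.var i)
  have hrow' : ∀ u, NonnegCoeffs (L - ∑ v, Y u v) := by
    intro u
    have h : L - ∑ v, Y u v =
        ∑ i, MvPolynomial.C (R - ∑ v, B i u v) * MvPolynomial.X i := by
      simp only [hL, hY, Matrix.of_apply]
      rw [Finset.sum_comm, Finset.mul_sum, ← Finset.sum_sub_distrib]
      simp only [map_sub, map_sum, sub_mul, Finset.sum_mul]
    rw [h]
    exact NonnegCoeffs.sum fun i _ =>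
      (NonnegCoeffs.const (sub_nonneg.2 (hrow i u))).mul (NonnegCoeffs.var i)
  obtain ⟨h₁, h₂⟩ := NonnegCoeffs.matrix_pow_rowSum hY0 hL0 hrow' q
  have htr : NonnegCoeffs (MvPolynomial.C (Fintype.card ι : ℝ) * L ^ q - (Y ^ q).trace) := by
    classical
    have h : MvPolynomial.C (Fintype.card ι : ℝ) * L ^ q - (Y ^ q).trace =
        ∑ u, ((L ^ q - ∑ v, (Y ^ q) u v) + ∑ v ∈ Finset.univ.erase u, (Y ^ q) u v) := by
      simp [Matrix.trace]
    rw [h]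
    exact NonnegCoeffs.sum fun u _ => (h₂ u).add (NonnegCoeffs.sum fun v _ => h₁ u v)
  refine ((integral_congr_ae (Filter.Eventually.of_forall fun g =>
    trace_sum_smul_pow_eq_eval B q g)).le.trans (integral_eval_gaussianPi_mono htr)).trans
      (le_of_eq ?_)
  rw [← integral_const_mul]
  refine integral_congr_ae (Filter.Eventually.of_forall fun g => ?_)
  simp [hL, mul_pow, mul_assoc]

/-- For symmetric `Y` the quadratic form is controlled by the trace of a power of `Y` with exponent
a power of two; this is the Cauchy–Schwarz inequality, iterated. -/
theorem quadForm_pow_le_trace [DecidableEq ι] (s : ℕ) {Y : Matrix ι ι ℝ} (hY : Y.IsSymm)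
    (z : ι → ℝ) :
    (z ⬝ᵥ Y.mulVec z) ^ 2 ^ (s + 1) ≤ (z ⬝ᵥ z) ^ 2 ^ (s + 1) * (Y ^ 2 ^ (s + 1)).trace := by
  induction s generalizing Y with
  | zero =>
    have htr : (Y ^ 2).trace = ∑ x : ι × ι, Y x.1 x.2 ^ 2 := by
      rw [Fintype.sum_prod_type, pow_two, Matrix.trace]
      simp only [Matrix.diag_apply, Matrix.mul_apply]
      refine Finset.sum_congr rfl fun u _ => Finset.sum_congr rfl fun v _ => ?_
      rw [hY.apply u v, pow_two]
    have hq : z ⬝ᵥ Y.mulVec z = ∑ x : ι × ι, (z x.1 * z x.2) * Y x.1 x.2 := by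
      rw [Fintype.sum_prod_type]
      simp only [dotProduct, Matrix.mulVec, Finset.mul_sum]
      exact Finset.sum_congr rfl fun u _ => Finset.sum_congr rfl fun v _ => by ring
    have hz : (z ⬝ᵥ z) ^ 2 = ∑ x : ι × ι, (z x.1 * z x.2) ^ 2 := by
      rw [Fintype.sum_prod_type, pow_two, dotProduct, Finset.sum_mul_sum]
      exact Finset.sum_congr rfl fun u _ => Finset.sum_congr rfl fun v _ => by ring
    simp only [zero_add, pow_one]
    rw [htr, hq, hz]
    exact Finset.sum_mul_sq_le_sq_mul_sq _ _ _
  | succ s ih =>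
    have hY2 : (Y ^ 2).IsSymm := hY.pow 2
    have hzz : 0 ≤ z ⬝ᵥ z := Finset.sum_nonneg fun u _ => mul_self_nonneg _
    have hcs : (z ⬝ᵥ Y.mulVec z) ^ 2 ≤ (z ⬝ᵥ z) * (z ⬝ᵥ (Y ^ 2).mulVec z) := by
      have h : z ⬝ᵥ (Y ^ 2).mulVec z = Y.mulVec z ⬝ᵥ Y.mulVec z := by
        rw [pow_two, ← Matrix.mulVec_mulVec, Matrix.dotProduct_mulVec, ← Matrix.mulVec_transpose,
          hY.eq]
      rw [h]
      simp only [dotProduct, ← pow_two]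
      exact Finset.sum_mul_sq_le_sq_mul_sq _ _ _
    have hQ : 2 ^ (s + 1 + 1) = 2 * 2 ^ (s + 1) := by ring
    calc (z ⬝ᵥ Y.mulVec z) ^ 2 ^ (s + 1 + 1)
        = ((z ⬝ᵥ Y.mulVec z) ^ 2) ^ 2 ^ (s + 1) := by rw [hQ, pow_mul]
      _ ≤ ((z ⬝ᵥ z) * (z ⬝ᵥ (Y ^ 2).mulVec z)) ^ 2 ^ (s + 1) := by
          gcongr
      _ = (z ⬝ᵥ z) ^ 2 ^ (s + 1) * (z ⬝ᵥ (Y ^ 2).mulVec z) ^ 2 ^ (s + 1) := mul_pow _ _ _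
      _ ≤ (z ⬝ᵥ z) ^ 2 ^ (s + 1) * ((z ⬝ᵥ z) ^ 2 ^ (s + 1) * ((Y ^ 2) ^ 2 ^ (s + 1)).trace) := by
          gcongr
          exact ih hY2
      _ = _ := by rw [← pow_mul, ← mul_assoc, ← pow_add, hQ, ← two_mul]

end Trace

/-! ### Words and single-letter replacements -/

section Words

variable {V : Type*} [DecidableEq V] {m : ℕ}

/-- The number of occurrences of the letter `a` in the word `w`, as a real number. -/
def letterCount (a : V) (w : Fin m → V) : ℝ := ∑ j, if w j = a then 1 else 0

/-- The number of positions at which replacing a letter `a` of `w` by `b` gives `w'`. -/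
def replacementCount (a b : V) (w w' : Fin m → V) : ℝ :=
  ∑ j, if w j = a ∧ w' = Function.update w j b then 1 else 0

theorem letterCount_nonneg (a : V) (w : Fin m → V) : 0 ≤ letterCount a w :=
  Finset.sum_nonneg fun _ _ => by split_ifs <;> norm_num

theorem replacementCount_nonneg (a b : V) (w w' : Fin m → V) : 0 ≤ replacementCount a b w w' :=
  Finset.sum_nonneg fun _ _ => by split_ifs <;> norm_num

theorem replacementCount_comm (a b : V) (w w' : Fin m → V) :
    replacementCount a b w w' = replacementCount b a w' w := by
  refine Finset.sum_congr rfl fun j _ => if_congr ?_ rfl rfl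
  constructor
  · rintro ⟨rfl, rfl⟩
    simp
  · rintro ⟨rfl, rfl⟩
    simp

theorem sum_replacementCount [Fintype V] (a b : V) (w : Fin m → V) :
    ∑ w', replacementCount a b w w' = letterCount a w := by
  unfold replacementCount letterCount
  rw [Finset.sum_comm]
  refine Finset.sum_congr rfl fun j _ => ?_
  by_cases h : w j = a <;> simp [h]

/-- A replacement of `a` by `b` changes the product of the signs of the letters by `y a * y b`. -/
theorem prod_mul_prod_mul_replacementCount {y : V → ℝ} (hy : ∀ v, y v * y v = 1) (a b : V)
    (w w' : Fin m → V) :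
    ((∏ j, y (w j)) * ∏ j, y (w' j)) * replacementCount a b w w' =
      (y a * y b) * replacementCount a b w w' := by
  unfold replacementCount
  rw [Finset.mul_sum, Finset.mul_sum]
  refine Finset.sum_congr rfl fun j _ => ?_
  split_ifs with h
  · obtain ⟨rfl, rfl⟩ := h
    rw [← Finset.prod_mul_distrib, ← Finset.mul_prod_erase _ _ (Finset.mem_univ j),
      Finset.prod_eq_one, Function.update_self]
    · ring
    · intro i hi
      rw [Function.update_of_ne (Finset.ne_of_mem_erase hi), hy]
  · simp

/-- Averaging over words with a prescribed letter at `j` is averaging over all words with the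
letter at `j` overwritten. -/
theorem card_mul_sum_ite [Fintype V] (j : Fin m) (a : V) (H : (Fin m → V) → ℝ) :
    Fintype.card V * ∑ w : Fin m → V, (if w j = a then H w else 0) =
      ∑ w : Fin m → V, H (Function.update w j a) := by
  rw [← Finset.sum_filter, ← nsmul_eq_mul, ← Finset.card_univ, ← Finset.sum_const,
    ← Finset.sum_product']
  refine Finset.sum_bij' (fun x _ => Function.update x.2 j x.1)
    (fun w _ => (w j, Function.update w j a)) ?_ ?_ ?_ ?_ ?_
  · simp
  · simp
  · rintro ⟨x, w⟩ h
    simp only [Finset.mem_product, Finset.mem_filter, Finset.mem_univ, true_and] at h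
    simp [← h]
  · simp
  · rintro ⟨x, w⟩ h
    simp only [Finset.mem_product, Finset.mem_filter, Finset.mem_univ, true_and] at h
    simp [← h]

theorem card_mul_sum_letterCount [Fintype V] (a : V) :
    Fintype.card V * ∑ w : Fin m → V, letterCount a w = m * (Fintype.card V : ℝ) ^ m := by
  unfold letterCount
  rw [Finset.sum_comm, Finset.mul_sum,
    Finset.sum_congr rfl fun j _ => card_mul_sum_ite j a fun _ => (1 : ℝ)]
  simp

theorem letterCount_update_le (j : Fin m) (a b : V) (w : Fin m → V) :
    letterCount b (Function.update w j a) ≤ (if b = a then 1 else 0) + letterCount b w := by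
  unfold letterCount
  rw [← Finset.add_sum_erase _ _ (Finset.mem_univ j),
    ← Finset.add_sum_erase (f := fun j => if w j = b then (1 : ℝ) else 0) _ (Finset.mem_univ j),
    Function.update_self]
  have h : ∑ i ∈ Finset.univ.erase j, (if Function.update w j a i = b then (1 : ℝ) else 0) =
      ∑ i ∈ Finset.univ.erase j, (if w i = b then (1 : ℝ) else 0) :=
    Finset.sum_congr rfl fun i hi => by rw [Function.update_of_ne (Finset.ne_of_mem_erase hi)]
  rw [h, if_congr eq_comm rfl rfl]
  have : (0 : ℝ) ≤ if w j = b then 1 else 0 := by split_ifs <;> norm_num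
  linarith

/-- Occurrences of two letters in a random word are essentially uncorrelated, except for the
diagonal term when the letters agree. -/
theorem sum_letterCount_mul_letterCount_le [Fintype V] [Nonempty V] (a b : V) :
    ∑ w : Fin m → V, letterCount a w * letterCount b w ≤
      ((if b = a then 1 else 0) + m / Fintype.card V) * ∑ w : Fin m → V, letterCount a w := by
  have hn : (0 : ℝ) < Fintype.card V := by exact_mod_cast Fintype.card_pos
  have h1 : ∀ j : Fin m, Fintype.card V *
      ∑ w : Fin m → V, (if w j = a then letterCount b w else 0) ≤
      ((if b = a then 1 else 0) + m / Fintype.card V) * (Fintype.card V : ℝ) ^ m := by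
    intro j
    rw [card_mul_sum_ite]
    refine (Finset.sum_le_sum fun w _ => letterCount_update_le j a b w).trans (le_of_eq ?_)
    rw [Finset.sum_add_distrib]
    rw [← mul_right_inj' hn.ne', mul_add, card_mul_sum_letterCount]
    simp only [Finset.sum_const, Finset.card_univ, Fintype.card_fun, Fintype.card_fin,
      nsmul_eq_mul, Nat.cast_pow]
    field_simp
  refine le_of_mul_le_mul_left ?_ hn
  rw [mul_left_comm, card_mul_sum_letterCount]
  have h2 : ∀ w : Fin m → V, letterCount a w * letterCount b w =
      ∑ j, if w j = a then letterCount b w else 0 := fun w => by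
    rw [letterCount, Finset.sum_mul]
    exact Finset.sum_congr rfl fun j _ => by split_ifs <;> simp
  simp only [h2]
  rw [Finset.sum_comm, Finset.mul_sum]
  refine (Finset.sum_le_sum fun j _ => h1 j).trans (le_of_eq ?_)
  simp
  ring

end Words

/-! ### Block words and pruned Kikuchi matrices -/

section Blocks

variable {V : Type*} [DecidableEq V] {m r : ℕ}

/-- The number of ways to choose one position in every block `p c` of the block word `p` such that
the chosen letters are `a c`. -/
def blockCount (a : Fin r → V) (p : Fin r → Fin m → V) : ℝ := ∏ c, letterCount (a c) (p c)

/-- The number of ways to choose one letter `a c` in every block `p c` such that replacing it by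
`b c` gives the block word `q`. This is the Kikuchi matrix of the edge `{a c, b c | c}`. -/
def blockReplacementCount (a b : Fin r → V) (p q : Fin r → Fin m → V) : ℝ :=
  ∏ c, replacementCount (a c) (b c) (p c) (q c)

/-- The number of edges, counted with the position choices of `blockCount`, whose left half `a S`
occurs in the block word `p`. -/
def blockDegree {κ : Type*} (M : Finset κ) (a : κ → Fin r → V) (p : Fin r → Fin m → V) : ℝ :=
  ∑ S ∈ M, blockCount (a S) p

theorem blockCount_nonneg (a : Fin r → V) (p : Fin r → Fin m → V) : 0 ≤ blockCount a p :=
  Finset.prod_nonneg fun _ _ => letterCount_nonneg _ _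

theorem blockReplacementCount_nonneg (a b : Fin r → V) (p q : Fin r → Fin m → V) :
    0 ≤ blockReplacementCount a b p q :=
  Finset.prod_nonneg fun _ _ => replacementCount_nonneg _ _ _ _

theorem blockDegree_nonneg {κ : Type*} (M : Finset κ) (a : κ → Fin r → V)
    (p : Fin r → Fin m → V) : 0 ≤ blockDegree M a p :=
  Finset.sum_nonneg fun _ _ => blockCount_nonneg _ _

theorem blockReplacementCount_comm (a b : Fin r → V) (p q : Fin r → Fin m → V) :
    blockReplacementCount a b p q = blockReplacementCount b a q p :=
  Finset.prod_congr rfl fun _ _ => replacementCount_comm _ _ _ _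

/-- The product of the signs `y v` of all letters of the block word `p`. -/
def blockSign (y : V → ℝ) (p : Fin r → Fin m → V) : ℝ := ∏ c, ∏ j, y (p c j)

omit [DecidableEq V] in
theorem blockSign_mul_self {y : V → ℝ} (hy : ∀ v, y v * y v = 1) (p : Fin r → Fin m → V) :
    blockSign y p * blockSign y p = 1 := by
  simp [blockSign, ← Finset.prod_mul_distrib, hy]

theorem blockSign_mul_blockSign_mul {y : V → ℝ} (hy : ∀ v, y v * y v = 1) (a b : Fin r → V)
    (p q : Fin r → Fin m → V) :
    blockSign y p * blockSign y q * blockReplacementCount a b p q =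
      (∏ c, y (a c) * y (b c)) * blockReplacementCount a b p q := by
  simp only [blockSign, blockReplacementCount, ← Finset.prod_mul_distrib]
  exact Finset.prod_congr rfl fun c _ => by
    rw [Finset.prod_mul_distrib]
    exact prod_mul_prod_mul_replacementCount hy _ _ _ _

variable [Fintype V]

theorem sum_blockReplacementCount (a b : Fin r → V) (p : Fin r → Fin m → V) :
    ∑ q, blockReplacementCount a b p q = blockCount a p := by
  unfold blockReplacementCount blockCount
  rw [← Fintype.prod_sum fun c w' => replacementCount (a c) (b c) (p c) w']
  simp only [sum_replacementCount]

theorem sum_blockReplacementCount' (a b : Fin r → V) (q : Fin r → Fin m → V) :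
    ∑ p, blockReplacementCount a b p q = blockCount b q := by
  simp only [blockReplacementCount_comm a b]
  exact sum_blockReplacementCount _ _ _

variable (V m) in
/-- The number of pairs of a word of length `m` and an occurrence in it of a given letter. -/
noncomputable def letterTotal : ℝ := m * (Fintype.card V : ℝ) ^ m / Fintype.card V

omit [DecidableEq V] in
theorem letterTotal_nonneg : 0 ≤ letterTotal V m := by
  unfold letterTotal
  positivity

theorem sum_letterCount [Nonempty V] (a : V) :
    ∑ w : Fin m → V, letterCount a w = letterTotal V m := by
  have hn : (Fintype.card V : ℝ) ≠ 0 := by exact_mod_cast Fintype.card_ne_zero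
  rw [letterTotal, eq_div_iff hn, mul_comm, card_mul_sum_letterCount]

theorem sum_blockCount [Nonempty V] (a : Fin r → V) :
    ∑ p : Fin r → Fin m → V, blockCount a p = letterTotal V m ^ r := by
  unfold blockCount
  rw [← Fintype.prod_sum fun c w => letterCount (a c) w]
  simp [sum_letterCount]

theorem sum_blockCount_mul_blockCount_le [Nonempty V] (a b : Fin r → V) :
    ∑ p : Fin r → Fin m → V, blockCount a p * blockCount b p ≤
      letterTotal V m ^ r * ∏ c, ((if b c = a c then 1 else 0) + (m : ℝ) / Fintype.card V) := by
  simp only [blockCount, ← Finset.prod_mul_distrib]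
  rw [← Fintype.prod_sum fun c w => letterCount (a c) w * letterCount (b c) w]
  have h : letterTotal V m ^ r = ∏ _c : Fin r, letterTotal V m := by simp
  rw [h, ← Finset.prod_mul_distrib]
  refine Finset.prod_le_prod (fun c _ => Finset.sum_nonneg fun w _ =>
    mul_nonneg (letterCount_nonneg _ _) (letterCount_nonneg _ _)) fun c _ => ?_
  refine (sum_letterCount_mul_letterCount_le _ _).trans (le_of_eq ?_)
  rw [sum_letterCount, mul_comm]

/-- A product of terms `1[P c] + x` with `0 ≤ x ≤ 1` is at most `x ^ r` if no `P c` holds, and at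
most `2 ^ r` otherwise. -/
theorem prod_ite_add_le {P : Fin r → Prop} [DecidablePred P] {x : ℝ} (hx : 0 ≤ x) (hx1 : x ≤ 1) :
    ∏ c, ((if P c then 1 else 0) + x) ≤ ∑ c, (if P c then 2 ^ r else 0) + x ^ r := by
  by_cases h : ∃ c, P c
  · obtain ⟨c, hc⟩ := h
    have h1 : ∏ c, ((if P c then 1 else 0) + x) ≤ 2 ^ r := by
      have : (2 : ℝ) ^ r = ∏ _c : Fin r, 2 := by simp
      rw [this]
      refine Finset.prod_le_prod (fun c _ => ?_) fun c _ => ?_ <;> split_ifs <;> linarith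
    have h2 : (2 : ℝ) ^ r ≤ ∑ c, (if P c then 2 ^ r else 0) := by
      have := Finset.single_le_sum (f := fun c => if P c then (2 : ℝ) ^ r else 0)
        (fun c _ => by split_ifs <;> positivity) (Finset.mem_univ c)
      simpa [hc] using this
    have h3 : 0 ≤ x ^ r := by positivity
    linarith
  · push Not at h
    simp [h]

/-- Every letter occurs at every place of at most `t` of the tuples `a S`, `S ∈ M`. -/
def HasLetterMultiplicity {κ : Type*} (M : Finset κ) (a : κ → Fin r → V) (t : ℕ) : Prop :=
  ∀ c v, (M.filter fun S => a S c = v).card ≤ t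

theorem HasLetterMultiplicity.card_le {κ : Type*} {M : Finset κ} {a : κ → Fin r → V} {t : ℕ}
    (h : HasLetterMultiplicity M a t) (hr : 0 < r) : M.card ≤ Fintype.card V * t := by
  rw [mul_comm]
  exact Finset.card_le_mul_card_image_of_maps_to (f := fun S => a S ⟨0, hr⟩)
    (fun _ _ => Finset.mem_univ _) _ fun v _ => h _ _

/-- The mean degree of a block word containing a given edge is of order `t` as soon as
`|V| (m / |V|) ^ r` is bounded. -/
theorem sum_blockCount_mul_blockDegree_le [Nonempty V] {κ : Type*} {M : Finset κ}
    {a : κ → Fin r → V} {t : ℕ} (h : HasLetterMultiplicity M a t) (hr : 0 < r)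
    (hm : m ≤ Fintype.card V)
    (hm' : (Fintype.card V : ℝ) * ((m : ℝ) / Fintype.card V) ^ r ≤ 2) (a₀ : Fin r → V) :
    ∑ p : Fin r → Fin m → V, blockCount a₀ p * blockDegree M a p ≤
      letterTotal V m ^ r * (t * (r * 2 ^ r + 2)) := by
  have hn : (0 : ℝ) < Fintype.card V := by exact_mod_cast Fintype.card_pos
  set x : ℝ := (m : ℝ) / Fintype.card V with hx
  have hx0 : 0 ≤ x := by positivity
  have hx1 : x ≤ 1 := (div_le_one hn).2 (by exact_mod_cast hm)
  have hD := letterTotal_nonneg (V := V) (m := m)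
  simp only [blockDegree, Finset.mul_sum]
  rw [Finset.sum_comm]
  refine (Finset.sum_le_sum fun S _ => sum_blockCount_mul_blockCount_le a₀ (a S)).trans ?_
  rw [← Finset.mul_sum]
  refine mul_le_mul_of_nonneg_left ?_ (by positivity)
  refine (Finset.sum_le_sum fun S _ => prod_ite_add_le hx0 hx1).trans ?_
  rw [Finset.sum_add_distrib, Finset.sum_comm, mul_add]
  have h1 : ∑ c : Fin r, ∑ S ∈ M, (if a S c = a₀ c then (2 : ℝ) ^ r else 0) ≤ t * (r * 2 ^ r) := by
    have : ∀ c : Fin r, ∑ S ∈ M, (if a S c = a₀ c then (2 : ℝ) ^ r else 0) ≤ t * 2 ^ r := by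
      intro c
      rw [← Finset.sum_filter, Finset.sum_const, nsmul_eq_mul]
      gcongr
      exact h c (a₀ c)
    refine (Finset.sum_le_sum fun c _ => this c).trans (le_of_eq ?_)
    simp
    ring
  have h2 : ∑ S ∈ M, x ^ r ≤ t * 2 := by
    rw [Finset.sum_const, nsmul_eq_mul]
    have hc : (M.card : ℝ) ≤ Fintype.card V * t := by exact_mod_cast h.card_le hr
    calc (M.card : ℝ) * x ^ r ≤ (Fintype.card V * t) * x ^ r := by gcongr
      _ = t * (Fintype.card V * x ^ r) := by ring
      _ ≤ t * 2 := by gcongr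
  exact add_le_add h1 h2

/-- Markov's inequality: the block words of degree above four times the mean carry at most a quarter
of the occurrences of any edge. -/
theorem sum_blockCount_of_large_degree_le [Nonempty V] {κ : Type*} {M : Finset κ}
    {a : κ → Fin r → V} {t : ℕ} (h : HasLetterMultiplicity M a t) (ht : 0 < t) (hr : 0 < r)
    (hm : m ≤ Fintype.card V)
    (hm' : (Fintype.card V : ℝ) * ((m : ℝ) / Fintype.card V) ^ r ≤ 2) (a₀ : Fin r → V) :
    ∑ p : Fin r → Fin m → V,
        (if blockDegree M a p ≤ 4 * (t * (r * 2 ^ r + 2)) then 0 else blockCount a₀ p) ≤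
      letterTotal V m ^ r / 4 := by
  set E : ℝ := t * (r * 2 ^ r + 2) with hE
  have hE0 : 0 < E := by positivity
  have h1 : ∀ p : Fin r → Fin m → V, (if blockDegree M a p ≤ 4 * E then 0 else blockCount a₀ p) ≤
      (blockCount a₀ p * blockDegree M a p) / (4 * E) := by
    intro p
    have hb := blockCount_nonneg a₀ p
    have hd := blockDegree_nonneg M a p
    split_ifs with hp
    · positivity
    · rw [le_div_iff₀ (by positivity)]
      exact mul_le_mul_of_nonneg_left (not_le.1 hp).le hb
  refine (Finset.sum_le_sum fun p _ => h1 p).trans ?_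
  rw [← Finset.sum_div, div_le_iff₀ (by positivity)]
  refine (sum_blockCount_mul_blockDegree_le h hr hm hm' a₀).trans (le_of_eq ?_)
  rw [← hE]
  ring

/-- Pruned and reweighted Kikuchi matrices: the forms `∑ S ∈ M, ∏ c, y (a S c) * y (b S c)` at sign
vectors `y` are quadratic forms at sign vectors of a nonnegative matrix with row sums `O(t)`. -/
theorem exists_kikuchi_matrix [Nonempty V] {κ : Type*} {M : Finset κ}
    {a b : κ → Fin r → V} {t : ℕ} (ha : HasLetterMultiplicity M a t)
    (hb : HasLetterMultiplicity M b t) (ht : 0 < t) (hr : 0 < r) (hm0 : 0 < m)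
    (hm : m ≤ Fintype.card V)
    (hm' : (Fintype.card V : ℝ) * ((m : ℝ) / Fintype.card V) ^ r ≤ 2) :
    ∃ B : Matrix (Fin r → Fin m → V) (Fin r → Fin m → V) ℝ, B.IsSymm ∧ (∀ p q, 0 ≤ B p q) ∧
      (∀ p, ∑ q, B p q ≤ 8 * (t * (r * 2 ^ r + 2))) ∧
      ∀ y : V → ℝ, (∀ v, y v * y v = 1) →
        blockSign y ⬝ᵥ B.mulVec (blockSign y) =
          letterTotal V m ^ r * ∑ S ∈ M, ∏ c, y (a S c) * y (b S c) := by
  set Δ : ℝ := 4 * (t * (r * 2 ^ r + 2)) with hΔ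
  have hΔ0 : 0 < Δ := by positivity
  have hD : 0 < letterTotal V m := by
    have : (0 : ℝ) < Fintype.card V := by exact_mod_cast Fintype.card_pos
    unfold letterTotal
    positivity
  set D : ℝ := letterTotal V m ^ r with hDdef
  have hD0 : 0 < D := by positivity
  -- the entries of the Kikuchi matrix of `S` that survive the pruning
  set K : κ → (Fin r → Fin m → V) → (Fin r → Fin m → V) → ℝ := fun S p q =>
    if blockDegree M a p ≤ Δ ∧ blockDegree M b q ≤ Δ then blockReplacementCount (a S) (b S) p q
    else 0 with hK
  have hK0 : ∀ S p q, 0 ≤ K S p q := fun S p q => by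
    simp only [hK]
    split_ifs
    · exact blockReplacementCount_nonneg _ _ _ _
    · exact le_rfl
  have hKle : ∀ S p q, K S p q ≤ blockReplacementCount (a S) (b S) p q := fun S p q => by
    simp only [hK]
    split_ifs
    · exact le_rfl
    · exact blockReplacementCount_nonneg _ _ _ _
  set W : κ → ℝ := fun S => ∑ p, ∑ q, K S p q with hW
  have hWD : ∀ S, D / 2 ≤ W S := by
    intro S
    have hpt : ∀ p q, blockReplacementCount (a S) (b S) p q -
        (if blockDegree M a p ≤ Δ then 0 else blockReplacementCount (a S) (b S) p q) -
        (if blockDegree M b q ≤ Δ then 0 else blockReplacementCount (a S) (b S) p q) ≤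
          K S p q := by
      intro p q
      have := blockReplacementCount_nonneg (a S) (b S) p q
      simp only [hK]
      split_ifs <;> simp_all
    have hsum := Finset.sum_le_sum fun p (_ : p ∈ Finset.univ) =>
      Finset.sum_le_sum fun q (_ : q ∈ Finset.univ) => hpt p q
    simp only [Finset.sum_sub_distrib] at hsum
    have e1 : ∑ p : Fin r → Fin m → V, ∑ q : Fin r → Fin m → V,
        blockReplacementCount (a S) (b S) p q = D := by
      simp only [sum_blockReplacementCount, sum_blockCount, hDdef]
    have e2 : ∑ p : Fin r → Fin m → V, ∑ q : Fin r → Fin m → V,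
        (if blockDegree M a p ≤ Δ then 0 else blockReplacementCount (a S) (b S) p q) ≤ D / 4 := by
      refine le_trans (le_of_eq (Finset.sum_congr rfl fun p _ => ?_))
        (sum_blockCount_of_large_degree_le ha ht hr hm hm' (a S))
      rw [← sum_blockReplacementCount (a S) (b S)]
      split_ifs <;> simp
    have e3 : ∑ p : Fin r → Fin m → V, ∑ q : Fin r → Fin m → V,
        (if blockDegree M b q ≤ Δ then 0 else blockReplacementCount (a S) (b S) p q) ≤ D / 4 := by
      rw [Finset.sum_comm]
      refine le_trans (le_of_eq (Finset.sum_congr rfl fun p _ => ?_))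
        (sum_blockCount_of_large_degree_le hb ht hr hm hm' (b S))
      rw [← sum_blockReplacementCount' (a S) (b S)]
      split_ifs <;> simp
    linarith
  have hW0 : ∀ S, 0 < W S := fun S => lt_of_lt_of_le (by positivity) (hWD S)
  -- the weight `D / (2 * W S)` makes the contributions of all edges equal
  set A : Matrix (Fin r → Fin m → V) (Fin r → Fin m → V) ℝ :=
    Matrix.of fun p q => ∑ S ∈ M, D / (2 * W S) * K S p q with hA
  have hwt : ∀ S, 0 ≤ D / (2 * W S) := fun S => by have := hW0 S; positivity
  have hwt1 : ∀ S, D / (2 * W S) ≤ 1 := fun S => by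
    rw [div_le_one (by have := hW0 S; positivity)]
    linarith [hWD S]
  have hA0 : ∀ p q, 0 ≤ A p q := fun p q =>
    Finset.sum_nonneg fun S _ => mul_nonneg (hwt S) (hK0 S p q)
  have hAle : ∀ p q, A p q ≤ ∑ S ∈ M, K S p q := fun p q =>
    Finset.sum_le_sum fun S _ => mul_le_of_le_one_left (hK0 S p q) (hwt1 S)
  have hrow : ∀ p, ∑ q, A p q ≤ Δ := by
    intro p
    refine (Finset.sum_le_sum fun q _ => hAle p q).trans ?_
    rw [Finset.sum_comm]
    by_cases hp : blockDegree M a p ≤ Δ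
    · refine le_trans (Finset.sum_le_sum fun S _ => Finset.sum_le_sum fun q _ => hKle S p q) ?_
      simp only [sum_blockReplacementCount]
      exact hp
    · simp [hK, hp, hΔ0.le]
  have hcol : ∀ q, ∑ p, A p q ≤ Δ := by
    intro q
    refine (Finset.sum_le_sum fun p _ => hAle p q).trans ?_
    rw [Finset.sum_comm]
    by_cases hq : blockDegree M b q ≤ Δ
    · refine le_trans (Finset.sum_le_sum fun S _ => Finset.sum_le_sum fun p _ => hKle S p q) ?_
      simp only [sum_blockReplacementCount']
      exact hq
    · simp [hK, hq, hΔ0.le]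
  refine ⟨A + A.transpose, Matrix.isSymm_add_transpose_self A, fun p q => ?_, fun p => ?_,
    fun y hy => ?_⟩
  · exact add_nonneg (hA0 p q) (hA0 q p)
  · have := add_le_add (hrow p) (hcol p)
    simp only [Matrix.add_apply, Matrix.transpose_apply, Finset.sum_add_distrib]
    linarith
  · have hform : blockSign y ⬝ᵥ A.mulVec (blockSign y) =
        D / 2 * ∑ S ∈ M, ∏ c, y (a S c) * y (b S c) := by
      have hpq : ∀ S p q, blockSign y p * (K S p q * blockSign y q) =
          (∏ c, y (a S c) * y (b S c)) * K S p q := by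
        intro S p q
        simp only [hK]
        split_ifs
        · rw [← blockSign_mul_blockSign_mul hy]
          ring
        · simp
      calc blockSign y ⬝ᵥ A.mulVec (blockSign y)
          = ∑ p, ∑ q, ∑ S ∈ M, D / (2 * W S) * ((∏ c, y (a S c) * y (b S c)) * K S p q) := by
            simp only [dotProduct, Matrix.mulVec, hA, Matrix.of_apply, Finset.mul_sum,
              Finset.sum_mul, ← hpq]
            exact Finset.sum_congr rfl fun p _ => Finset.sum_congr rfl fun q _ =>
              Finset.sum_congr rfl fun S _ => by ring
        _ = ∑ S ∈ M, D / (2 * W S) * ((∏ c, y (a S c) * y (b S c)) * W S) := by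
            rw [Finset.sum_congr rfl fun p _ => Finset.sum_comm, Finset.sum_comm]
            simp only [hW, Finset.mul_sum]
        _ = _ := by
            rw [Finset.mul_sum]
            refine Finset.sum_congr rfl fun S _ => ?_
            have := (hW0 S).ne'
            field_simp
    have hT : blockSign y ⬝ᵥ A.transpose.mulVec (blockSign y) =
        blockSign y ⬝ᵥ A.mulVec (blockSign y) := by
      rw [Matrix.mulVec_transpose, dotProduct_comm, ← Matrix.dotProduct_mulVec]
    rw [Matrix.add_mulVec, dotProduct_add, hT, hform]
    ring

end Blocks

/-! ### The expected supremum over sign vectors -/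

theorem exists_two_pow_between {x : ℝ} (hx : 1 < x) :
    ∃ s : ℕ, x ≤ 2 ^ (s + 1) ∧ (2 : ℝ) ^ (s + 1) ≤ 2 * x := by
  obtain ⟨n, hn, hn'⟩ := exists_nat_pow_near hx.le (by norm_num : (1 : ℝ) < 2)
  refine ⟨n, hn'.le, ?_⟩
  rw [pow_succ]
  linarith

/-- Passing from a high moment to the first moment without Jensen's inequality. -/
theorem le_add_mul_div_pow {x a : ℝ} (ha : 0 < a) {q : ℕ} (hq : Even q) (hq0 : q ≠ 0) :
    x ≤ a + a * (x / a) ^ q := by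
  rcases le_total x a with h | h
  · have : 0 ≤ a * (x / a) ^ q := mul_nonneg ha.le (hq.pow_nonneg _)
    linarith
  · have h1 : x / a ≤ (x / a) ^ q := le_self_pow₀ ((one_le_div ha).2 h) hq0
    have h2 : x = a * (x / a) := by field_simp
    have h3 : a * (x / a) ≤ a * (x / a) ^ q := mul_le_mul_of_nonneg_left h1 ha.le
    linarith

section Majorant

variable {V : Type*} [DecidableEq V] [Fintype V] [Nonempty V] {m r k t : ℕ}

/-- The random forms `∑ gᵢ ∑ S ∈ Mᵢ, ∏ c, y (aᵢ S c) * y (bᵢ S c)` are, simultaneously at all sign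
vectors `y`, at most a random variable with the stated expectation. -/
theorem exists_integrable_majorant {κ : Type*} {M : Fin k → Finset κ}
    {a b : Fin k → κ → Fin r → V} (ha : ∀ i, HasLetterMultiplicity (M i) (a i) t)
    (hb : ∀ i, HasLetterMultiplicity (M i) (b i) t) (hk : 0 < k) (ht : 0 < t) (hr : 0 < r)
    (hm0 : 0 < m) (hm : m ≤ Fintype.card V) (hV : 4 ≤ Fintype.card V)
    (hm' : (Fintype.card V : ℝ) * ((m : ℝ) / Fintype.card V) ^ r ≤ 2) :
    ∃ Z : (Fin k → ℝ) → ℝ, Integrable Z (gaussianPi k) ∧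
      (∫ g, Z g ∂(gaussianPi k) ≤ 3 * (Real.exp 1 * (((Fintype.card V : ℝ) / m) ^ r *
        (8 * (t * (r * 2 ^ r + 2)) * Real.sqrt (Real.exp 1 *
          (k * (2 * (r * m * Real.log (Fintype.card V))))))))) ∧
      ∀ y : V → ℝ, (∀ v, y v * y v = 1) → ∀ g : Fin k → ℝ,
        ∑ i, g i * ∑ S ∈ M i, ∏ c, y (a i S c) * y (b i S c) ≤ Z g := by
  have hn : (0 : ℝ) < Fintype.card V := by exact_mod_cast Fintype.card_pos
  have hm0' : (0 : ℝ) < m := by exact_mod_cast hm0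
  set n : ℝ := (Fintype.card V : ℝ) with hndef
  set R : ℝ := 8 * (t * (r * 2 ^ r + 2)) with hR
  have hR0 : 0 < R := by positivity
  have hlog : 1 < Real.log n := by
    rw [Real.lt_log_iff_exp_lt hn]
    have : (4 : ℝ) ≤ n := by rw [hndef]; exact_mod_cast hV
    linarith [Real.exp_one_lt_three]
  have hrm : (1 : ℝ) ≤ r * m := by exact_mod_cast Nat.mul_pos hr hm0
  -- `logN` is the logarithm of the number of block words
  set logN : ℝ := r * m * Real.log n with hlogN
  have hlogN1 : 1 < logN := by
    calc (1 : ℝ) < Real.log n := hlog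
      _ ≤ r * m * Real.log n := le_mul_of_one_le_left (by linarith) hrm
  obtain ⟨s, hs1, hs2⟩ := exists_two_pow_between hlogN1
  choose B hBsymm hB0 hBrow hBform using fun i =>
    exists_kikuchi_matrix (ha i) (hb i) ht hr hm0 hm hm'
  set q : ℕ := 2 ^ (s + 1) with hq
  have hqp : q = 2 * 2 ^ s := by rw [hq, pow_succ, mul_comm]
  have hqeven : Even q := ⟨2 ^ s, by omega⟩
  have hq0 : q ≠ 0 := by positivity
  have hqcast : (q : ℝ) = 2 ^ (s + 1) := by simp [hq]
  have hk' : (0 : ℝ) < k := by exact_mod_cast hk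
  set ρ : ℝ := (n / m) ^ r with hρ
  have hρ0 : 0 < ρ := by positivity
  have hq0' : (0 : ℝ) < q := by positivity
  set σ : ℝ := Real.sqrt (Real.exp 1 * (k * q)) with hσ
  have hσ0 : 0 < σ := Real.sqrt_pos.2 (by positivity)
  set α : ℝ := Real.exp 1 * (ρ * (R * σ)) with hα
  have hα0 : 0 < α := by positivity
  have hD : letterTotal V m ^ r * ρ = n ^ (m * r) := by
    rw [hρ, ← mul_pow, letterTotal, ← hndef, pow_mul]
    congr 1
    field_simp
  have hD0 : 0 < letterTotal V m ^ r := by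
    refine pos_of_mul_pos_left ?_ hρ0.le
    rw [hD]
    positivity
  have hN : (Fintype.card (Fin r → Fin m → V) : ℝ) = n ^ (m * r) := by
    simp [hndef, pow_mul]
  have hNlog : n ^ (m * r) = Real.exp logN := by
    rw [hlogN, ← Real.exp_log hn, Real.log_exp, ← Real.exp_nat_mul]
    push_cast
    ring_nf
  refine ⟨fun g => α + α * ((ρ / α) ^ q * ((∑ i, g i • B i) ^ q).trace),
    (integrable_const _).add (((integrable_trace_sum_smul_pow B q).const_mul _).const_mul _),
    ?_, ?_⟩
  · rw [integral_add (integrable_const _)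
      (((integrable_trace_sum_smul_pow B q).const_mul _).const_mul _), integral_const,
      integral_const_mul α, integral_const_mul ((ρ / α) ^ q), probReal_univ, one_smul]
    have h1 := integral_trace_sum_smul_pow_le hB0 hR0.le hBrow q
    have h2 : ∫ g : Fin k → ℝ, (∑ i, g i) ^ q ∂(gaussianPi k) ≤ 2 * σ ^ q := by
      have := integral_sum_pow_gaussianPi_le (k := k) (p := 2 ^ s) hk Nat.one_le_two_pow
      rw [← hqp] at this
      rwa [hσ, hqp, pow_mul, Real.sq_sqrt (by positivity), ← hqp]
    have h3 : (ρ / α) ^ q * ∫ g : Fin k → ℝ, ((∑ i, g i • B i) ^ q).trace ∂(gaussianPi k) ≤ 2 := by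
      have hle : ∫ g : Fin k → ℝ, ((∑ i, g i • B i) ^ q).trace ∂(gaussianPi k) ≤
          Real.exp logN * R ^ q * (2 * σ ^ q) := by
        refine h1.trans ?_
        rw [hN, hNlog]
        gcongr
      have hrat : ρ / α = (Real.exp 1 * (R * σ))⁻¹ := by
        rw [hα]
        field_simp
      calc _ ≤ (ρ / α) ^ q * (Real.exp logN * R ^ q * (2 * σ ^ q)) := by gcongr
        _ = 2 * (Real.exp logN / Real.exp 1 ^ q) := by
            rw [hrat, inv_pow, mul_pow, mul_pow]
            field_simp
        _ ≤ 2 := by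
            have : Real.exp logN / Real.exp 1 ^ q ≤ 1 := by
              rw [div_le_one (by positivity), ← Real.exp_nat_mul, mul_one, hqcast]
              exact Real.exp_le_exp.2 hs1
            linarith
    have hσle : σ ≤ Real.sqrt (Real.exp 1 * (k * (2 * logN))) := by
      rw [hσ, hqcast]
      gcongr
    calc _ ≤ α + α * 2 := by
            gcongr
      _ = 3 * α := by ring
      _ ≤ _ := by
          rw [hα]
          gcongr
  · intro y hy g
    set F : ℝ := ∑ i, g i * ∑ S ∈ M i, ∏ c, y (a i S c) * y (b i S c) with hF
    have hsymm : (∑ i, g i • B i).IsSymm := by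
      rw [Matrix.IsSymm, Matrix.transpose_sum]
      exact Finset.sum_congr rfl fun i _ => by rw [Matrix.transpose_smul, (hBsymm i).eq]
    have hform : blockSign y ⬝ᵥ (∑ i, g i • B i).mulVec (blockSign y) =
        letterTotal V m ^ r * F := by
      rw [Matrix.sum_mulVec, dotProduct_sum, hF, Finset.mul_sum]
      refine Finset.sum_congr rfl fun i _ => ?_
      rw [Matrix.smul_mulVec, dotProduct_smul, hBform i y hy, smul_eq_mul]
      ring
    have hzz : (blockSign y : (Fin r → Fin m → V) → ℝ) ⬝ᵥ blockSign y =
        letterTotal V m ^ r * ρ := by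
      simp only [dotProduct, blockSign_mul_self hy]
      rw [hD, ← hN]
      simp
    have hquad := quadForm_pow_le_trace s hsymm (blockSign y)
    rw [← hq, hform, hzz, mul_pow, mul_pow, mul_assoc] at hquad
    have hFq := le_of_mul_le_mul_left hquad (by positivity)
    refine (le_add_mul_div_pow hα0 hqeven hq0 (x := F)).trans ?_
    have : (F / α) ^ q ≤ (ρ / α) ^ q * ((∑ i, g i • B i) ^ q).trace := by
      rw [div_pow, div_pow, div_mul_eq_mul_div]
      gcongr
    exact add_le_add le_rfl (mul_le_mul_of_nonneg_left this hα0.le)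

end Majorant

/-! ### Points of the cube as averages of sign vectors -/

theorem finite_booleanCube (n : ℕ) : (booleanCube n).Finite := by
  have h : booleanCube n = Set.univ.pi fun _ => {0, 1} := by
    ext x
    simp [booleanCube]
  rw [h]
  exact Set.Finite.pi fun _ => (Set.finite_singleton 1).insert 0

theorem gaussianWidth_le_integral {k : ℕ} {T : Set (EuclideanSpace ℝ (Fin k))} (hT : T.Finite)
    (hne : T.Nonempty) {Z : (Fin k → ℝ) → ℝ} (hZ : Integrable Z (gaussianPi k))
    (hle : ∀ x ∈ T, ∀ g : Fin k → ℝ, ∑ i, g i * x i ≤ Z g) :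
    gaussianWidth T ≤ ∫ g, Z g ∂(gaussianPi k) := by
  have : Nonempty T := hne.to_subtype
  have hint := integrable_iSup_inner_of_finite hT hne
  have hmeas : Measurable (WithLp.toLp 2 : (Fin k → ℝ) → EuclideanSpace ℝ (Fin k)) := by fun_prop
  unfold gaussianWidth
  rw [← map_pi_eq_stdGaussian] at hint ⊢
  rw [integral_map hmeas.aemeasurable hint.aestronglyMeasurable]
  refine integral_mono (hint.comp_measurable hmeas) hZ fun g => ciSup_le fun x => ?_
  refine le_of_eq_of_le ?_ (hle x x.2 g)
  simp [PiLp.inner_apply]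

/-- A nonempty set of at most `|I|` points is the image of a map on `I`. -/
theorem exists_image_eq_of_card_le {I α : Type*} [Fintype I] [DecidableEq α]
    {s : Finset α} (hs : s.Nonempty) (hcard : s.card ≤ Fintype.card I) :
    ∃ e : I → α, Finset.univ.image e = s := by
  have : Nonempty s := hs.to_subtype
  obtain ⟨f⟩ := Function.Embedding.nonempty_of_card_le (α := s) (β := I) (by simpa using hcard)
  refine ⟨fun i => (Function.invFun f i : s), ?_⟩
  ext x
  simp only [Finset.mem_image, Finset.mem_univ, true_and]
  constructor
  · rintro ⟨i, rfl⟩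
    exact Subtype.coe_prop _
  · intro hx
    exact ⟨f ⟨x, hx⟩, by rw [Function.leftInverse_invFun f.injective]⟩

/-- On the cube a monomial only depends on the set of its variables, so a product over a list with
repetitions of these variables gives the same value. -/
theorem prod_pow_eq_prod_of_mem_booleanCube {n : ℕ} {x : Fin n → ℝ} (hx : x ∈ booleanCube n)
    {I : Type*} [Fintype I] {μ : Fin n →₀ ℕ} {e : I → Fin n}
    (he : Finset.univ.image e = μ.support) :
    ∏ j ∈ μ.support, x j ^ μ j = ∏ c, x (e c) := by
  have hmem : ∀ c, e c ∈ μ.support := fun c => by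
    rw [← he]
    exact Finset.mem_image_of_mem _ (Finset.mem_univ _)
  by_cases h : ∃ j ∈ μ.support, x j = 0
  · obtain ⟨j, hj, hj0⟩ := h
    have hj' := hj
    rw [← he, Finset.mem_image] at hj'
    obtain ⟨c, _, rfl⟩ := hj'
    rw [Finset.prod_eq_zero hj (by rw [hj0, zero_pow (Finsupp.mem_support_iff.1 hj)]),
      Finset.prod_eq_zero (Finset.mem_univ c) hj0]
  · push Not at h
    have h1 : ∀ j ∈ μ.support, x j = 1 := fun j hj => (hx j).resolve_left (h j hj)
    rw [Finset.prod_eq_one fun j hj => by rw [h1 j hj, one_pow],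
      Finset.prod_eq_one fun c _ => h1 _ (hmem c)]

/-- The signs attached to a point `x` of the cube: the letter `(j, true)` stands for `2 * x j - 1`,
the letter `(j, false)` for the constant `1`. -/
def cubeSign {n : ℕ} (x : Fin n → ℝ) (v : Fin n × Bool) : ℝ := if v.2 then 2 * x v.1 - 1 else 1

theorem cubeSign_mul_self {n : ℕ} {x : Fin n → ℝ} (hx : x ∈ booleanCube n) (v : Fin n × Bool) :
    cubeSign x v * cubeSign x v = 1 := by
  unfold cubeSign
  rcases hx v.1 with h | h <;> split_ifs <;> norm_num [h]

theorem prod_eq_sum_prod_cubeSign {n r : ℕ} (x : Fin n → ℝ) (e : Fin r ⊕ Fin r → Fin n) :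
    ∏ c, x (e c) = (2 ^ (2 * r))⁻¹ * ∑ τ : Fin r ⊕ Fin r → Bool,
      ∏ c : Fin r, cubeSign x (e (Sum.inl c), τ (Sum.inl c)) *
        cubeSign x (e (Sum.inr c), τ (Sum.inr c)) := by
  have h : ∀ c, x (e c) = 2⁻¹ * ∑ β : Bool, cubeSign x (e c, β) := fun c => by
    simp [cubeSign]
  rw [Finset.prod_congr rfl fun c _ => h c, Finset.prod_mul_distrib, Fintype.prod_sum]
  congr 1
  · simp [two_mul]
  · refine Finset.sum_congr rfl fun τ _ => ?_
    rw [Fintype.prod_sum_type, Finset.prod_mul_distrib]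

theorem card_support_le_of_totalDegree_le {n d : ℕ} {p : MvPolynomial (Fin n) ℝ}
    (hp : p.totalDegree ≤ d) {μ : Fin n →₀ ℕ} (hμ : μ ∈ p.support) : μ.support.card ≤ d := by
  refine le_trans ?_ ((MvPolynomial.le_totalDegree hμ).trans hp)
  rw [Finset.card_eq_sum_ones]
  exact Finset.sum_le_sum fun j hj => Nat.one_le_iff_ne_zero.2 (Finsupp.mem_support_iff.1 hj)

theorem eval_eq_coeff_zero_add {n : ℕ} {p : MvPolynomial (Fin n) ℝ} (hp : HasZeroOneCoeffs p)
    (x : Fin n → ℝ) : MvPolynomial.eval x p =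
      p.coeff 0 + ∑ μ ∈ p.support.erase 0, ∏ j ∈ μ.support, x j ^ μ j := by
  have h1 : ∀ μ ∈ p.support, p.coeff μ = 1 := fun μ hμ =>
    (hp μ).resolve_left (MvPolynomial.mem_support_iff.1 hμ)
  have h2 : ∑ μ ∈ p.support.erase 0, ∏ j ∈ μ.support, x j ^ μ j =
      ∑ μ ∈ p.support.erase 0, p.coeff μ * ∏ j ∈ μ.support, x j ^ μ j :=
    Finset.sum_congr rfl fun μ hμ => by rw [h1 μ (Finset.mem_of_mem_erase hμ), one_mul]
  rw [MvPolynomial.eval_eq, h2]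
  by_cases h0 : (0 : Fin n →₀ ℕ) ∈ p.support
  · rw [← Finset.add_sum_erase _ _ h0]
    simp
  · rw [Finset.erase_eq_of_notMem h0, MvPolynomial.notMem_support_iff.1 h0, zero_add]

theorem integrable_sum_mul_gaussianPi {k : ℕ} (c : Fin k → ℝ) :
    Integrable (fun g : Fin k → ℝ => ∑ i, g i * c i) (gaussianPi k) := by
  have h := integrable_eval_gaussianPi
    (∑ i, MvPolynomial.X i * MvPolynomial.C (c i) : MvPolynomial (Fin k) ℝ)
  simpa only [map_sum, map_mul, MvPolynomial.eval_X, MvPolynomial.eval_C] using h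

theorem integral_sum_mul_gaussianPi {k : ℕ} (c : Fin k → ℝ) :
    ∫ g : Fin k → ℝ, ∑ i, g i * c i ∂(gaussianPi k) = 0 := by
  have hi : ∀ i, Integrable (fun g : Fin k → ℝ => g i) (gaussianPi k) := fun i => by
    simpa using integrable_eval_gaussianPi (MvPolynomial.X i : MvPolynomial (Fin k) ℝ)
  rw [integral_finsetSum _ fun i _ => (hi i).mul_const _]
  refine Finset.sum_eq_zero fun i _ => ?_
  rw [integral_mul_const, integral_comp_eval (μ := fun _ : Fin k => gaussianReal 0 1)
    (f := fun x : ℝ => x) (by fun_prop), integral_id_gaussianReal, zero_mul]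

/-! ### The width of a polynomial image of the cube -/

section Width

variable {n k t d r : ℕ} {ψ : Fin k → MvPolynomial (Fin n) ℝ}

theorem gaussianWidth_nonpos_of_support_eq (h : ∀ i, HasZeroOneCoeffs (ψ i))
    (h0 : ∀ i, (ψ i).support.erase 0 = ∅) :
    gaussianWidth (polyMap ψ '' booleanCube n) ≤ 0 := by
  rw [← integral_sum_mul_gaussianPi fun i => (ψ i).coeff 0]
  refine gaussianWidth_le_integral ((finite_booleanCube n).image _)
    (Set.Nonempty.image _ ⟨0, fun j => Or.inl rfl⟩) (integrable_sum_mul_gaussianPi _) ?_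
  rintro _ ⟨x, -, rfl⟩ g
  simp [polyMap, eval_eq_coeff_zero_add (h _), h0]

/-- The width bound with the block length `m` still free. -/
theorem gaussianWidth_polyMap_le {m : ℕ} (hψ : ∀ i, HasZeroOneCoeffs (ψ i))
    (hd : ∀ i, (ψ i).totalDegree ≤ d) (hmul : ∀ i, HasMultiplicity (ψ i) t) (hdr : d ≤ 2 * r)
    (hn : 2 ≤ n) (hk : 0 < k) (ht : 0 < t) (hr : 0 < r) (hm0 : 0 < m) (hm : m ≤ n * 2)
    (hm' : (n * 2 : ℝ) * (m / (n * 2)) ^ r ≤ 2) :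
    gaussianWidth (polyMap ψ '' booleanCube n) ≤
      3 * (Real.exp 1 * ((n * 2 / m : ℝ) ^ r * (8 * (t * (r * 2 ^ r + 2)) *
        Real.sqrt (Real.exp 1 * (k * (2 * (r * m * Real.log (n * 2)))))))) := by
  have : NeZero n := ⟨by omega⟩
  have hcard : Fintype.card (Fin n × Bool) = n * 2 := by simp
  -- an enumeration, with repetitions, of the variables of every monomial by `2 * r` indices
  have hex : ∀ μ : Fin n →₀ ℕ, ∃ e : Fin r ⊕ Fin r → Fin n,
      μ ≠ 0 → μ.support.card ≤ d → Finset.univ.image e = μ.support := by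
    intro μ
    by_cases h : μ ≠ 0 ∧ μ.support.card ≤ d
    · obtain ⟨e, he⟩ := exists_image_eq_of_card_le (I := Fin r ⊕ Fin r)
        (Finsupp.support_nonempty_iff.2 h.1) (by simp; omega)
      exact ⟨e, fun _ _ => he⟩
    · exact ⟨fun _ => 0, fun h1 h2 => absurd ⟨h1, h2⟩ h⟩
  choose e he using hex
  have he' : ∀ i, ∀ μ ∈ (ψ i).support.erase 0, Finset.univ.image (e μ) = μ.support :=
    fun i μ hμ => he μ (Finset.ne_of_mem_erase hμ)
      (card_support_le_of_totalDegree_le (hd i) (Finset.mem_of_mem_erase hμ))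
  have hlm : ∀ (τ : Fin r ⊕ Fin r → Bool) (f : Fin r → Fin r ⊕ Fin r) (i : Fin k),
      HasLetterMultiplicity ((ψ i).support.erase 0) (fun μ c => (e μ (f c), τ (f c))) t := by
    intro τ f i c v
    refine (Finset.card_le_card fun μ hμ => ?_).trans (hmul i v.1)
    rw [Finset.mem_filter] at hμ ⊢
    refine ⟨Finset.mem_of_mem_erase hμ.1, ?_⟩
    rw [← Finsupp.mem_support_iff, ← he' i μ hμ.1, ← hμ.2]
    exact Finset.mem_image_of_mem _ (Finset.mem_univ _)
  choose Z hZint hZle hZ using fun τ : Fin r ⊕ Fin r → Bool =>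
    exists_integrable_majorant (V := Fin n × Bool) (m := m) (hlm τ Sum.inl) (hlm τ Sum.inr) hk ht
      hr hm0 (by rw [hcard]; exact hm) (by rw [hcard]; omega)
      (by rw [hcard]; push_cast; exact hm')
  rw [hcard] at hZle
  push_cast at hZle
  set bound : ℝ := 3 * (Real.exp 1 * ((n * 2 / m : ℝ) ^ r * (8 * (t * (r * 2 ^ r + 2)) *
        Real.sqrt (Real.exp 1 * (k * (2 * (r * m * Real.log (n * 2)))))))) with hbound
  have hint : Integrable (fun g => ∑ i, g i * (ψ i).coeff 0 + (2 ^ (2 * r))⁻¹ * ∑ τ, Z τ g)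
      (gaussianPi k) :=
    (integrable_sum_mul_gaussianPi _).add
      ((integrable_finsetSum _ fun τ _ => hZint τ).const_mul _)
  refine (gaussianWidth_le_integral ((finite_booleanCube n).image _)
    (Set.Nonempty.image _ ⟨0, fun j => Or.inl rfl⟩) hint ?_).trans ?_
  · rintro _ ⟨x, hx, rfl⟩ g
    have heval : ∀ i, MvPolynomial.eval x (ψ i) = (ψ i).coeff 0 + (2 ^ (2 * r))⁻¹ *
        ∑ τ : Fin r ⊕ Fin r → Bool, ∑ μ ∈ (ψ i).support.erase 0,
          ∏ c : Fin r, cubeSign x (e μ (Sum.inl c), τ (Sum.inl c)) *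
            cubeSign x (e μ (Sum.inr c), τ (Sum.inr c)) := by
      intro i
      rw [eval_eq_coeff_zero_add (hψ i), Finset.sum_comm, Finset.mul_sum]
      congr 1
      refine Finset.sum_congr rfl fun μ hμ => ?_
      rw [prod_pow_eq_prod_of_mem_booleanCube hx (he' i μ hμ), prod_eq_sum_prod_cubeSign]
    have hsum : ∑ i, g i * MvPolynomial.eval x (ψ i) = ∑ i, g i * (ψ i).coeff 0 +
        (2 ^ (2 * r))⁻¹ * ∑ τ : Fin r ⊕ Fin r → Bool, ∑ i, g i *
          ∑ μ ∈ (ψ i).support.erase 0,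
            ∏ c : Fin r, cubeSign x (e μ (Sum.inl c), τ (Sum.inl c)) *
              cubeSign x (e μ (Sum.inr c), τ (Sum.inr c)) := by
      rw [Finset.sum_comm, Finset.mul_sum, ← Finset.sum_add_distrib]
      refine Finset.sum_congr rfl fun i _ => ?_
      rw [heval, ← Finset.mul_sum]
      ring
    change ∑ i, g i * MvPolynomial.eval x (ψ i) ≤ _
    rw [hsum]
    gcongr with τ
    exact hZ τ _ (cubeSign_mul_self hx) g
  · rw [integral_add (integrable_sum_mul_gaussianPi _)
      ((integrable_finsetSum _ fun τ _ => hZint τ).const_mul _), integral_sum_mul_gaussianPi,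
      zero_add, integral_const_mul, integral_finsetSum _ fun τ _ => hZint τ]
    calc (2 ^ (2 * r))⁻¹ * ∑ τ, ∫ g, Z τ g ∂(gaussianPi k)
        ≤ (2 ^ (2 * r))⁻¹ * ∑ _τ : Fin r ⊕ Fin r → Bool, bound := by
          gcongr with τ
          exact hZle τ
      _ = bound := by simp [two_mul]

end Width

/-- The choice of the block length `m`, which is `n ^ (1 - 1 / r)` rounded up. -/
theorem exists_blockLength {n r : ℕ} (hn : 2 ≤ n) (hr : 0 < r) :
    ∃ m : ℕ, 0 < m ∧ m ≤ n * 2 ∧ (n * 2 : ℝ) * (m / (n * 2)) ^ r ≤ 2 ∧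
      (m : ℝ) ≤ 2 * (n : ℝ) ^ (1 - 1 / (r : ℝ)) ∧ (n * 2 / m : ℝ) ^ r ≤ 2 ^ r * n := by
  have hn1 : (1 : ℝ) ≤ n := by exact_mod_cast (by omega : 1 ≤ n)
  have hn0 : (0 : ℝ) < n := by linarith
  have hr0 : (0 : ℝ) < r := by exact_mod_cast hr
  have hr1 : 1 / (r : ℝ) ≤ 1 := (div_le_one hr0).2 (by exact_mod_cast hr)
  set P : ℝ := (n : ℝ) ^ (1 - 1 / (r : ℝ)) with hP
  have hP1 : 1 ≤ P := Real.one_le_rpow hn1 (by linarith)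
  have hP0 : 0 < P := by linarith
  have hPn : P ≤ n := by
    calc P ≤ (n : ℝ) ^ (1 : ℝ) := Real.rpow_le_rpow_of_exponent_le hn1 (by
          have : 0 < 1 / (r : ℝ) := by positivity
          linarith)
      _ = n := Real.rpow_one _
  have hPr : n * P ^ r = (n : ℝ) ^ r := by
    rw [hP, ← Real.rpow_natCast, ← Real.rpow_mul hn0.le, ← Real.rpow_natCast]
    nth_rewrite 1 [← Real.rpow_one (n : ℝ)]
    rw [← Real.rpow_add hn0]
    congr 1
    field_simp
    ring
  have hm2 : (⌈P⌉₊ : ℝ) ≤ 2 * P := by linarith [Nat.ceil_lt_add_one hP0.le]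
  have hmP : P ≤ (⌈P⌉₊ : ℝ) := Nat.le_ceil P
  have hm0 : (0 : ℝ) < (⌈P⌉₊ : ℝ) := by linarith
  refine ⟨⌈P⌉₊, Nat.ceil_pos.2 hP0, ?_, ?_, hm2, ?_⟩
  · have : (⌈P⌉₊ : ℝ) ≤ ((n * 2 : ℕ) : ℝ) := by push_cast; linarith
    exact_mod_cast this
  · calc (n * 2 : ℝ) * (⌈P⌉₊ / (n * 2)) ^ r ≤ (n * 2 : ℝ) * (2 * P / (n * 2)) ^ r := by gcongr
      _ = 2 * (n * P ^ r) / n ^ r := by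
          have : 2 * P / (n * 2) = P / n := by field_simp
          rw [this, div_pow]
          ring
      _ ≤ 2 := by
          rw [hPr]
          field_simp
          exact le_rfl
  · calc (n * 2 / ⌈P⌉₊ : ℝ) ^ r ≤ (n * 2 / P) ^ r := by gcongr
      _ = 2 ^ r * n := by
          rw [div_pow, mul_pow, ← hPr]
          field_simp

theorem theorem1 (d : ℕ) (hd : 1 ≤ d) :
    ∃ C : ℝ, 0 < C ∧
      ∀ (n k t : ℕ) (ψ : Fin k → MvPolynomial (Fin n) ℝ), 2 ≤ n →
        (∀ i, IsMultilinearPoly (ψ i)) →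
        (∀ i, HasZeroOneCoeffs (ψ i)) →
        (∀ i, (ψ i).totalDegree ≤ d) →
        (∀ i, HasMultiplicity (ψ i) t) →
        gaussianWidth (polyMap ψ '' booleanCube n) ≤
          C * ((n : ℝ) * (t : ℝ) *
            Real.sqrt ((k : ℝ) * (n : ℝ) ^ (1 - 1 / (⌈(d : ℝ) / 2⌉₊ : ℝ)) * Real.log (n : ℝ))) := by
  have hd0 : (0 : ℝ) < d := by exact_mod_cast hd
  set r : ℕ := ⌈(d : ℝ) / 2⌉₊ with hrdef
  have hr : 0 < r := Nat.ceil_pos.2 (by positivity)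
  have hdr : d ≤ 2 * r := by
    have h : (d : ℝ) / 2 ≤ r := Nat.le_ceil _
    have : (d : ℝ) ≤ ((2 * r : ℕ) : ℝ) := by push_cast; linarith
    exact_mod_cast this
  have hr0 : (0 : ℝ) < r := by exact_mod_cast hr
  refine ⟨3 * (Real.exp 1 * (2 ^ r * (8 * (r * 2 ^ r + 2) * Real.sqrt (8 * Real.exp 1 * r)))),
    by positivity, fun n k t ψ hn _ h01 hdeg hmul => ?_⟩
  have hn0 : (0 : ℝ) < n := by exact_mod_cast (by omega : 0 < n)
  have hlogn : 0 < Real.log n := Real.log_pos (by exact_mod_cast hn)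
  by_cases htriv : k = 0 ∨ t = 0
  · refine (gaussianWidth_nonpos_of_support_eq h01 fun i => ?_).trans (by positivity)
    rcases htriv with rfl | rfl
    · exact i.elim0
    · refine Finset.eq_empty_of_forall_notMem fun μ hμ => ?_
      obtain ⟨j, hj⟩ := Finsupp.ne_iff.1 (Finset.ne_of_mem_erase hμ)
      have := Finset.card_pos.2 ⟨μ, (Finset.mem_filter (p := fun μ => μ j ≠ 0)).2 ⟨Finset.mem_of_mem_erase hμ, hj⟩⟩
      exact absurd (hmul i j) (Nat.not_le.2 this)
  push Not at htriv
  obtain ⟨m, hm0, hm, hm', hmP, hmr⟩ := exists_blockLength hn hr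
  refine (gaussianWidth_polyMap_le h01 hdeg hmul hdr hn (Nat.pos_of_ne_zero htriv.1)
    (Nat.pos_of_ne_zero htriv.2) hr hm0 hm hm').trans ?_
  set P : ℝ := (n : ℝ) ^ (1 - 1 / (r : ℝ)) with hP
  have hP0 : 0 < P := Real.rpow_pos_of_pos hn0 _
  have hlog2 : Real.log (n * 2) ≤ 2 * Real.log n := by
    rw [Real.log_mul hn0.ne' two_ne_zero]
    have := Real.log_le_log two_pos (show (2 : ℝ) ≤ n by exact_mod_cast hn)
    linarith
  have hlog0 : 0 ≤ Real.log (n * 2) := Real.log_nonneg (by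
    have : (2 : ℝ) ≤ n := by exact_mod_cast hn
    linarith)
  have hsqrt : Real.sqrt (Real.exp 1 * (k * (2 * (r * m * Real.log (n * 2))))) ≤
      Real.sqrt (8 * Real.exp 1 * r) * Real.sqrt (k * P * Real.log n) := by
    rw [← Real.sqrt_mul (by positivity)]
    refine Real.sqrt_le_sqrt ?_
    calc Real.exp 1 * (k * (2 * (r * m * Real.log (n * 2))))
        ≤ Real.exp 1 * (k * (2 * (r * (2 * P) * (2 * Real.log n)))) := by gcongr
      _ = _ := by ring
  calc _ ≤ 3 * (Real.exp 1 * ((2 ^ r * n) * (8 * (t * (r * 2 ^ r + 2)) *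
        (Real.sqrt (8 * Real.exp 1 * r) * Real.sqrt (k * P * Real.log n))))) := by gcongr
    _ = _ := by ring
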